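/- Let $k$ be an algebraically closed field of arbitrary characteristic, let $n$ be a natural number, and let $f\in k[x_1,\dots,x_n]$ be a nonzero polynomial. Let $w=(w(x_1),\dots,w(x_n))\in(\mathbb{Z}_{\ge 0})^n\setminus\{0\}$ be a weight, and let $w(f)$ be the weighted multiplicity of $f$, i.e. the lowest weight $\sum_i m_i w(x_i)$ of the monomials $x_1^{m_1}\cdots x_n^{m_n}$ occurring in $f$ with nonzero coefficient. Then $$\frac{1}{\operatorname{lct}_0(\mathbb{A}^n_k,\operatorname{div}(f))}\ \ge\ \frac{w(f)}{\sum_{i=1}^n w(x_i)} .$$ Here $\operatorname{lct}_0(\mathbb{A}^n_k,\operatorname{div}(f))\in[0,\infty]$ is the log canonical threshold at the origin, that is, the supremum of all real $c\ge 0$ such that for some open neighbourhood $U$ of $0$ the pair $(U,c\cdot\operatorname{div}(f)|_U)$ is log canonical: for every birational morphism $\pi:Y\to U$ from a normal variety $Y$ over $k$ and every prime divisor $E\subset Y$, the discrepancy $a$ of $E$, defined by $K_Y=\pi^*(K_U+c\cdot\operatorname{div}(f))+aE$ near the generic point of $E$, satisfies $a\ge -1$. The conventions $1/\infty=0$ and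 $1/0=\infty$ are used. -/

import Mathlib

open CategoryTheory AlgebraicGeometry
open scoped ENNReal NNReal KaehlerDifferential

universe u

noncomputable section

namespace LogCanonical

/-- A normal variety over a field `k` (with structure morphism `s`): an integral separated scheme
of finite type over `k`, all of whose local rings are integrally closed. -/
structure IsNormalVariety (k : Type u) [Field k] {Y : Scheme.{u}}
    (s : Y ⟶ Spec (CommRingCat.of k)) : Prop where
  isIntegral : AlgebraicGeometry.IsIntegral Y
  isSeparated : IsSeparated s
  locallyOfFiniteType : LocallyOfFiniteType s
  quasiCompact : QuasiCompact s
  isIntegrallyClosed : ∀ y : Y, IsIntegrallyClosed (Y.presheaf.stalk y)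

/-- A prime divisor over a scheme `X` over a field `k`: a birational morphism `π : Y ⟶ X` from a
normal variety `Y` over `k`, together with a prime divisor `E ⊆ Y`, represented by its generic
point (a point of codimension one of `Y`). -/
structure PrimeDivisorOver (k : Type u) [Field k] {X : Scheme.{u}}
    (s : X ⟶ Spec (CommRingCat.of k)) where
  /-- the model on which the divisor lives -/
  Y : Scheme.{u}
  /-- the morphism to the base -/
  π : Y ⟶ X
  isNormalVariety : IsNormalVariety k (π ≫ s)
  /-- `π` restricts to an isomorphism between dense open subschemes of `Y` and of `X` -/
  birational : Scheme.BirationalOver π (𝟙 X)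
  /-- the generic point of the divisor `E` -/
  genericPoint : Y
  codim_one : Order.coheight genericPoint = 1

/-- Affine `n`-space over `k`. -/
abbrev affineSpace (k : Type u) [Field k] (n : ℕ) : Scheme.{u} :=
  Spec (CommRingCat.of (MvPolynomial (Fin n) k))

/-- The structure morphism of affine `n`-space over `k`. -/
def affineSpaceToBase (k : Type u) [Field k] (n : ℕ) :
    affineSpace k n ⟶ Spec (CommRingCat.of k) :=
  Spec.map (CommRingCat.ofHom MvPolynomial.C)

/-- The origin of affine `n`-space: the maximal ideal of polynomials vanishing at `0`. -/
def origin (k : Type u) [Field k] (n : ℕ) : affineSpace k n :=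
  (⟨RingHom.ker (MvPolynomial.constantCoeff : MvPolynomial (Fin n) k →+* k),
    RingHom.ker_isPrime _⟩ : PrimeSpectrum (MvPolynomial (Fin n) k))

/-- Pull-back of functions along `g : Y ⟶ Spec R`, followed by passing to germs at `y`. -/
def pullbackGerm {R : CommRingCat.{u}} {Y : Scheme.{u}} (g : Y ⟶ Spec R) (y : Y) :
    R →+* Y.presheaf.stalk y :=
  ((Scheme.ΓSpecIso R).inv ≫ g.appTop ≫ Y.presheaf.germ ⊤ y trivial).hom

/-- The order of vanishing of an element `s` of a module `M` over a local ring `(R, 𝔪)`, that is,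
the supremum of all `m` with `s ∈ 𝔪 ^ m M`. If `R` is a discrete valuation ring and `M` is free of
rank one with basis `e`, then the order of `r • e` is the normalized valuation of `r`. -/
def vanishingOrder (R : Type u) [CommRing R] [IsLocalRing R] {M : Type u} [AddCommGroup M]
    [Module R M] (s : M) : ℕ∞ :=
  ⨆ (m : ℕ) (_ : s ∈ (IsLocalRing.maximalIdeal R ^ m) • (⊤ : Submodule R M)), (m : ℕ∞)

/-- For a ring homomorphism `φ` from `k[x₁, …, xₙ]` to a local ring `R`, the order of vanishing of
the pulled back volume form `dφ(x₁) ∧ ⋯ ∧ dφ(xₙ)` as an element of `⋀ⁿ Ω_{R/k}`. -/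
def volumeFormOrder {k : Type u} [Field k] {n : ℕ} {R : Type u} [CommRing R] [IsLocalRing R]
    (φ : MvPolynomial (Fin n) k →+* R) : ℕ∞ :=
  letI : Algebra k R := (φ.comp MvPolynomial.C).toAlgebra
  vanishingOrder R
    (exteriorPower.ιMulti R n fun i => KaehlerDifferential.D k R (φ (MvPolynomial.X i)))

section Pairs

variable {k : Type u} [Field k] {n : ℕ}

/-- The discrepancy `a(E; U, c · div f)` of a prime divisor `E` over an open subscheme `U` of
affine `n`-space over a perfect field `k`, for `f ≠ 0`.
The form `ω = dx₁ ∧ ⋯ ∧ dxₙ` is a nowhere vanishing section of the canonical sheaf of `U`, so that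
`K_U = div ω = 0`. On `Y`, the canonical sheaf is `⋀ⁿ Ω_{Y/k}` near the generic point of `E`, and
`K_Y = div (π^* ω)`. Thus `K_Y = π^* (K_U + c · div f) + a E` near the generic point of `E` means
`a = ord_E (π^* ω) - c · ord_E (π^* f)`. Both orders are finite, since `π` is birational. -/
def discrepancy (U : (affineSpace k n).Opens) (f : MvPolynomial (Fin n) k) (c : ℝ≥0)
    (E : PrimeDivisorOver k (U.ι ≫ affineSpaceToBase k n)) : ℝ :=
  ((volumeFormOrder (pullbackGerm (E.π ≫ U.ι) E.genericPoint)).toNat : ℝ) -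
    c * ((vanishingOrder (E.Y.presheaf.stalk E.genericPoint)
      (pullbackGerm (E.π ≫ U.ι) E.genericPoint f)).toNat : ℝ)

/-- The pair `(U, c · div f)` is log canonical: all discrepancies are at least `-1`. -/
def IsLogCanonical (U : (affineSpace k n).Opens) (f : MvPolynomial (Fin n) k) (c : ℝ≥0) : Prop :=
  ∀ E : PrimeDivisorOver k (U.ι ≫ affineSpaceToBase k n), -1 ≤ discrepancy U f c E

/-- The pair `(𝔸ⁿ, c · div f)` is log canonical at the point `x`: its restriction to some open
neighbourhood of `x` is log canonical. -/
def IsLogCanonicalAt (x : affineSpace k n) (f : MvPolynomial (Fin n) k) (c : ℝ≥0) : Prop :=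
  ∃ U : (affineSpace k n).Opens, x ∈ U ∧ IsLogCanonical U f c

/-- The log canonical threshold `lct_x(𝔸ⁿ, div f)` at the point `x`, for `f ≠ 0`; it is `∞` if
`f` does not vanish at `x`. -/
def lctAt (x : affineSpace k n) (f : MvPolynomial (Fin n) k) : ℝ≥0∞ :=
  ⨆ (c : ℝ≥0) (_ : IsLogCanonicalAt x f c), (c : ℝ≥0∞)

/-- The weighted multiplicity `w(f)` of `f ≠ 0`: the lowest weight `∑ i, mᵢ w(xᵢ)` of the
monomials `x ^ m` occurring in `f`. -/
def weightedMultiplicity (w : Fin n → ℕ) (f : MvPolynomial (Fin n) k) : ℕ :=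
  sInf {d | ∃ m ∈ f.support, d = ∑ i, m i * w i}

end Pairs

end LogCanonical

end

/-!
Write `w = g v` with `v` primitive, and complete `v` to a unimodular matrix `B` of natural numbers,
with `v` as its `i`-th row. The monomial map `x_j ↦ ∏ l, x_l ^ B l j` is an isomorphism on the
torus, hence birational, and the hyperplane `E = {x_i = 0}` of its source is the exceptional divisor
of the weighted blow-up. The generic point of `E` is mapped to a generization of the origin, so `E`
lies over every neighbourhood of the origin. Along `E`, the polynomial `f` vanishes to order at
least `w(f) / g`, and the form `dx₁ ∧ ⋯ ∧ dxₙ` to order `∑ j, v_j - 1`, because monomial maps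
multiply `dx₁/x₁ ∧ ⋯ ∧ dxₙ/xₙ` by `det B = ±1`. Hence the discrepancy of `E` can only be at least
`-1` if `c w(f) ≤ ∑ j, w_j`.
-/

noncomputable section

namespace LogCanonical

section UnimodularMatrix

variable {σ : Type*} [Fintype σ] [DecidableEq σ]

/-- A square matrix of natural numbers is unimodular if it is invertible over the integers. The
chart of a toric blow-up of affine space is given by such a matrix of exponents. -/
def IsUnimodular (B : Matrix σ σ ℕ) : Prop :=
  IsUnit (B.map (Nat.castRingHom ℤ))

theorem isUnimodular_one : IsUnimodular (1 : Matrix σ σ ℕ) := by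
  simp [IsUnimodular]

theorem IsUnimodular.mul {A B : Matrix σ σ ℕ} (hA : IsUnimodular A) (hB : IsUnimodular B) :
    IsUnimodular (A * B) := by
  rw [IsUnimodular, Matrix.map_mul]
  exact IsUnit.mul hA hB

theorem isUnimodular_one_add_single {a b : σ} (hab : a ≠ b) :
    IsUnimodular (1 + Matrix.single a b 1 : Matrix σ σ ℕ) := by
  have h : (1 + Matrix.single a b 1 : Matrix σ σ ℕ).map (Nat.castRingHom ℤ) =
      Matrix.transvection a b 1 := by
    rw [Matrix.map_add _ (map_add _), Matrix.map_one _ (map_zero _) (map_one _),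
      Matrix.map_single, map_one, Matrix.transvection]
  rw [IsUnimodular, h, Matrix.isUnit_iff_isUnit_det, Matrix.det_transvection_of_ne _ _ hab]
  exact isUnit_one

theorem IsUnimodular.exists_col_ne_zero {B : Matrix σ σ ℕ} (hB : IsUnimodular B) (j : σ) :
    ∃ i, B i j ≠ 0 := by
  by_contra! h
  refine ((Matrix.isUnit_iff_isUnit_det _).mp hB).ne_zero ?_
  exact Matrix.det_eq_zero_of_column_eq_zero j fun i => by simp [h i]

theorem vecMul_one_add_single (v : σ → ℕ) (a b : σ) :
    Matrix.vecMul v (1 + Matrix.single a b 1) = Function.update v b (v b + v a) := by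
  ext l
  rw [Matrix.vecMul_add, Matrix.vecMul_one, Pi.add_apply, Matrix.vecMul_eq_sum, Finset.sum_apply]
  rcases eq_or_ne l b with rfl | hl
  · simp [Matrix.single_apply]
  · simp [hl, hl.symm]

/-- Euclid's algorithm: subtracting one nonzero entry of `w` from another is the inverse of a
transvection with nonnegative entries. -/
theorem exists_isUnimodular_smul_row_eq (w : σ → ℕ) (hw : w ≠ 0) :
    ∃ (B : Matrix σ σ ℕ) (i : σ) (g : ℕ), IsUnimodular B ∧ 0 < g ∧ g • B i = w := by
  induction h : ∑ i, w i using Nat.strong_induction_on generalizing w with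
  | _ s ih =>
  by_cases hpair : ∃ a b, a ≠ b ∧ 0 < w a ∧ w a ≤ w b
  · obtain ⟨a, b, hab, ha, hle⟩ := hpair
    have hlt : ∑ i, Function.update w b (w b - w a) i < ∑ i, w i :=
      Fintype.sum_strictMono (update_lt_self_iff.mpr (by omega))
    have hne : Function.update w b (w b - w a) ≠ 0 :=
      Function.ne_iff.mpr ⟨a, by simp [hab, ha.ne']⟩
    obtain ⟨B, i, g, hB, hg, hrow⟩ := ih _ (h ▸ hlt) _ hne rfl
    refine ⟨B * (1 + Matrix.single a b 1), i, g, hB.mul (isUnimodular_one_add_single hab), hg, ?_⟩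
    rw [Matrix.mul_apply_eq_vecMul, ← Matrix.smul_vecMul, hrow, vecMul_one_add_single]
    simp [hab, hle]
  · obtain ⟨i, hi⟩ := Function.ne_iff.mp hw
    have hzero (j : σ) (hj : j ≠ i) : w j = 0 := by
      by_contra hj0
      rcases le_total (w i) (w j) with hle | hle
      · exact hpair ⟨i, j, hj.symm, Nat.pos_of_ne_zero hi, hle⟩
      · exact hpair ⟨j, i, hj, Nat.pos_of_ne_zero hj0, hle⟩
    refine ⟨1, i, w i, isUnimodular_one, Nat.pos_of_ne_zero hi, funext fun j => ?_⟩
    rcases eq_or_ne j i with rfl | hj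
    · simp
    · simp [Matrix.one_apply_ne hj.symm, hzero j hj]

end UnimodularMatrix

section MonomialMap

open MvPolynomial

variable {σ : Type*} [Fintype σ] {k : Type*} [CommRing k]

variable (k) in
/-- The endomorphism `x_j ↦ ∏ i, x_i ^ B i j` of the polynomial ring given by a matrix `B` of
exponents: in coordinates, a chart of a toric blow-up of affine space. -/
def monomialMap (B : Matrix σ σ ℕ) : MvPolynomial σ k →ₐ[k] MvPolynomial σ k :=
  aeval fun j => ∏ i, X i ^ B i j

variable (B : Matrix σ σ ℕ)

theorem monomialMap_monomial (m : σ →₀ ℕ) (r : k) :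
    monomialMap k B (monomial m r) =
      monomial (Finsupp.equivFunOnFinite.symm (B.mulVec m)) r := by
  rw [monomialMap, aeval_monomial, monomial_eq, algebraMap_eq, Finsupp.prod_fintype _ _ (by simp),
    Finsupp.prod_fintype _ _ (by simp)]
  simp_rw [← Finset.prod_pow, ← pow_mul]
  rw [Finset.prod_comm]
  simp_rw [Finset.prod_pow_eq_pow_sum]
  rfl

theorem monomialMap_X (j : σ) :
    monomialMap k B (X j) = monomial (Finsupp.equivFunOnFinite.symm (B.col j)) 1 := by
  classical
  rw [X, monomialMap_monomial, Finsupp.single_eq_pi_single, Matrix.mulVec_single_one]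

theorem X_pow_dvd_monomialMap {i : σ} {d : ℕ} {f : MvPolynomial σ k}
    (hd : ∀ m ∈ f.support, d ≤ ∑ j, m j * B i j) : X i ^ d ∣ monomialMap k B f := by
  rw [f.as_sum, map_sum]
  refine Finset.dvd_sum fun m hm => ?_
  rw [monomialMap_monomial, X_pow_eq_monomial, monomial_dvd_monomial]
  refine ⟨Or.inr (Finsupp.single_le_iff.mpr ((hd m hm).trans_eq ?_)), one_dvd _⟩
  exact Finset.sum_congr rfl fun j _ => mul_comm _ _

theorem constantCoeff_monomialMap [DecidableEq σ] {B : Matrix σ σ ℕ} (hB : IsUnimodular B)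
    (p : MvPolynomial σ k) : constantCoeff (monomialMap k B p) = constantCoeff p := by
  suffices constantCoeff.comp (monomialMap k B : MvPolynomial σ k →+* MvPolynomial σ k) =
    constantCoeff from RingHom.congr_fun this p
  refine ringHom_ext (fun r => by simp) fun j => ?_
  obtain ⟨i, hi⟩ := hB.exists_col_ne_zero j
  simp only [monomialMap, RingHom.coe_comp, RingHom.coe_coe, Function.comp_apply, aeval_X,
    map_prod, map_pow, constantCoeff_X]
  exact Finset.prod_eq_zero (Finset.mem_univ i) (zero_pow hi)

theorem X_mul_pderiv_monomialMap_X (i j : σ) :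
    X i * pderiv i (monomialMap k B (X j)) =
      (B i j : MvPolynomial σ k) * monomialMap k B (X j) := by
  rw [monomialMap_X, X_mul_pderiv_monomial, nsmul_eq_mul]
  rfl

/-- The Jacobian determinant of the morphism of affine spaces with coordinates `p`. -/
def jacobianDet [DecidableEq σ] (p : σ → MvPolynomial σ k) : MvPolynomial σ k :=
  (Matrix.of fun i j => pderiv i (p j)).det

/-- The Jacobian with respect to the `d log x_i` is constant, with matrix of entries `B i j`. -/
theorem prod_X_mul_jacobianDet_monomialMap [DecidableEq σ] :
    (∏ i, X i) * jacobianDet (fun j => monomialMap k B (X j)) =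
      ((B.map (Nat.castRingHom ℤ)).det : MvPolynomial σ k) * ∏ j, monomialMap k B (X j) := by
  have hmat : Matrix.diagonal X * (Matrix.of fun i j => pderiv i (monomialMap k B (X j))) =
      (B.map (Nat.castRingHom ℤ)).map (Int.castRingHom (MvPolynomial σ k)) *
        Matrix.diagonal (fun j => monomialMap k B (X j)) := by
    ext1 i j
    simp only [Matrix.diagonal_mul, Matrix.mul_diagonal, Matrix.of_apply, Matrix.map_apply,
      X_mul_pderiv_monomialMap_X]
    simp
  have hdet := congrArg Matrix.det hmat
  rwa [Matrix.det_mul, Matrix.det_mul, Matrix.det_diagonal, Matrix.det_diagonal,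
    ← RingHom.mapMatrix_apply, ← RingHom.map_det] at hdet

end MonomialMap

section LaurentPolynomials

open MvPolynomial

variable {σ : Type*} [Fintype σ]

section ZPowProd

variable {G : Type*} [CommGroup G] (u : σ → G)

/-- The monomials `∏ i, u_i ^ A i j` in the family `u` whose exponents are the columns of `A`. -/
def zpowProd (A : Matrix σ σ ℤ) (j : σ) : G :=
  ∏ i, u i ^ A i j

theorem zpowProd_one [DecidableEq σ] : zpowProd u 1 = u := by
  ext j
  rw [zpowProd, Fintype.prod_eq_single j fun i hi => by rw [Matrix.one_apply_ne hi, zpow_zero],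
    Matrix.one_apply_eq, zpow_one]

theorem zpowProd_zpowProd (A C : Matrix σ σ ℤ) :
    zpowProd (zpowProd u A) C = zpowProd u (A * C) := by
  ext j
  have hsum (l : σ) : ∏ i, u l ^ (A l i * C i j) = u l ^ (A * C) l j :=
    (map_sum (zpowersHom G (u l)).toAdditive _ _).symm
  simp_rw [zpowProd, ← Finset.prod_zpow, ← zpow_mul]
  rw [Finset.prod_comm]
  simp_rw [hsum]

end ZPowProd

variable (σ) (k : Type*) [CommRing k]

/-- Laurent polynomials, the functions on the torus in affine space. -/
abbrev LaurentRing : Type _ :=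
  Localization.Away (∏ i, X i : MvPolynomial σ k)

variable {σ} {k}

theorem algebraMap_laurentRing_injective [IsDomain k] :
    Function.Injective (algebraMap (MvPolynomial σ k) (LaurentRing σ k)) :=
  IsLocalization.injective (M := Submonoid.powers (∏ i, X i)) _
    (powers_le_nonZeroDivisors_of_noZeroDivisors
      (Finset.prod_ne_zero_iff.mpr fun i _ => X_ne_zero i))

theorem isUnit_algebraMap_X (i : σ) :
    IsUnit (algebraMap (MvPolynomial σ k) (LaurentRing σ k) (X i)) :=
  isUnit_of_dvd_unit (map_dvd _ (Finset.dvd_prod_of_mem X (Finset.mem_univ i)))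
    (IsLocalization.Away.algebraMap_isUnit _)

variable (k) in
/-- The coordinate functions on the torus. -/
def laurentVar (i : σ) : (LaurentRing σ k)ˣ :=
  (isUnit_algebraMap_X i).unit

variable {S : Type*} [CommRing S] [Algebra k S]

theorem laurentRing_algHom_ext {φ ψ : LaurentRing σ k →ₐ[k] S}
    (h : ∀ j, φ (laurentVar k j).val = ψ (laurentVar k j).val) : φ = ψ :=
  IsLocalization.algHom_ext (Submonoid.powers (∏ i, X i : MvPolynomial σ k))
    (MvPolynomial.algHom_ext h)

/-- Evaluation of Laurent polynomials at a family of units. -/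
def laurentEval (u : σ → Sˣ) : LaurentRing σ k →ₐ[k] S :=
  IsLocalization.liftAlgHom (M := Submonoid.powers (∏ i, X i : MvPolynomial σ k))
    (f := aeval fun j => (u j : S)) <| by
      rintro ⟨_, m, rfl⟩
      simpa using (IsUnit.prod_univ_iff.mpr fun j => (u j).isUnit).pow m

theorem laurentEval_laurentVar (u : σ → Sˣ) (j : σ) :
    laurentEval (k := k) u (laurentVar k j).val = u j :=
  (IsLocalization.lift_eq _ _).trans (aeval_X _ j)

theorem laurentEval_zpowProd (u : σ → Sˣ) (A : Matrix σ σ ℤ) (j : σ) :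
    laurentEval (k := k) u (zpowProd (laurentVar k) A j).val = zpowProd u A j := by
  have hvar (i : σ) :
      Units.map (laurentEval (k := k) u : LaurentRing σ k →* S) (laurentVar k i) = u i :=
    Units.ext (laurentEval_laurentVar u i)
  have hmap : Units.map (laurentEval (k := k) u : LaurentRing σ k →* S)
      (zpowProd (laurentVar k) A j) = zpowProd u A j := by
    simp_rw [zpowProd, map_prod, map_zpow, hvar]
  exact congrArg Units.val hmap

theorem laurentEval_comp_laurentEval [DecidableEq σ] {A C : Matrix σ σ ℤ} (h : A * C = 1) :
    (laurentEval (zpowProd (laurentVar k) A)).comp (laurentEval (zpowProd (laurentVar k) C)) =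
      AlgHom.id k (LaurentRing σ k) := by
  refine laurentRing_algHom_ext fun j => ?_
  rw [AlgHom.comp_apply, laurentEval_laurentVar, laurentEval_zpowProd, zpowProd_zpowProd, h,
    zpowProd_one, AlgHom.id_apply]

variable (k) in
/-- The automorphism of the torus given by an invertible integer matrix. -/
def laurentEquiv [DecidableEq σ] (A : (Matrix σ σ ℤ)ˣ) : LaurentRing σ k ≃ₐ[k] LaurentRing σ k :=
  AlgEquiv.ofAlgHom (laurentEval (zpowProd (laurentVar k) A.val))
    (laurentEval (zpowProd (laurentVar k) A⁻¹.val))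
    (laurentEval_comp_laurentEval A.mul_inv) (laurentEval_comp_laurentEval A.inv_mul)

variable [DecidableEq σ] {B : Matrix σ σ ℕ} (hB : IsUnimodular B)

theorem algebraMap_monomialMap (p : MvPolynomial σ k) :
    algebraMap _ (LaurentRing σ k) (monomialMap k B p) =
      laurentEquiv k hB.unit (algebraMap _ _ p) := by
  suffices (IsScalarTower.toAlgHom k _ (LaurentRing σ k)).comp (monomialMap k B) =
      (laurentEquiv k hB.unit).toAlgHom.comp (IsScalarTower.toAlgHom k _ _) from
    DFunLike.congr_fun this p
  refine MvPolynomial.algHom_ext fun j => ?_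
  refine Eq.trans ?_ (laurentEval_laurentVar _ j).symm
  simp [monomialMap, zpowProd, laurentVar]

include hB in
theorem monomialMap_injective [IsDomain k] : Function.Injective (monomialMap k B) :=
  Function.Injective.of_comp (f := algebraMap _ (LaurentRing σ k)) <| by
    rw [funext (algebraMap_monomialMap hB) (f := _ ∘ _)]
    exact (laurentEquiv k hB.unit).injective.comp algebraMap_laurentRing_injective

end LaurentPolynomials

section VanishingOrder

variable {R : Type u} [CommRing R] [IsLocalRing R]
  {M : Type u} [AddCommGroup M] [Module R M] {N : Type u} [AddCommGroup N] [Module R N]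

theorem natCast_le_vanishingOrder_iff {s : M} {d : ℕ} :
    d ≤ vanishingOrder R s ↔ s ∈ (IsLocalRing.maximalIdeal R ^ d) • (⊤ : Submodule R M) := by
  refine ⟨fun h => ?_, fun h => le_iSup₂_of_le d h le_rfl⟩
  by_contra hs
  have hlt (m : ℕ) (hm : s ∈ (IsLocalRing.maximalIdeal R ^ m) • (⊤ : Submodule R M)) : m < d := by
    by_contra! hle
    exact hs (Submodule.smul_mono_left (Ideal.pow_le_pow_right hle) hm)
  obtain _ | d := d
  · simp at hs
  · have hle : vanishingOrder R s ≤ d :=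
      iSup₂_le fun m hm => by exact_mod_cast Nat.lt_succ_iff.mp (hlt m hm)
    exact absurd (Nat.cast_le.mp (h.trans hle)) (Nat.not_succ_le_self d)

theorem vanishingOrder_le_map (ℓ : M →ₗ[R] N) (s : M) :
    vanishingOrder R s ≤ vanishingOrder R (ℓ s) := by
  refine ENat.forall_natCast_le_iff_le.mp fun d hd => ?_
  rw [natCast_le_vanishingOrder_iff] at hd ⊢
  have hmem := Submodule.mem_map_of_mem (f := ℓ) hd
  rw [Submodule.map_smul''] at hmem
  exact Submodule.smul_mono le_rfl le_top hmem

theorem vanishingOrder_algebraMap {A : Type*} [CommRing A] [IsDomain A] [Algebra A R] {p : A}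
    (hp : Prime p) [(Ideal.span {p}).IsPrime] [IsLocalization.AtPrime R (Ideal.span {p})] (a : A) :
    vanishingOrder R (algebraMap A R a) = emultiplicity p a := by
  refine ENat.eq_of_forall_natCast_le_iff fun d => ?_
  rw [natCast_le_vanishingOrder_iff, smul_eq_mul, Ideal.mul_top,
    ← IsLocalization.AtPrime.map_eq_maximalIdeal (Ideal.span {p}) R, ← Ideal.map_pow,
    Ideal.span_singleton_pow,
    IsLocalization.algebraMap_mem_map_algebraMap_iff (Ideal.span {p}).primeCompl,
    ← pow_dvd_iff_le_emultiplicity]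
  refine ⟨fun ⟨m, hm, hmem⟩ => ?_, fun h => ⟨1, one_mem _, ?_⟩⟩
  · rw [Ideal.mem_span_singleton] at hmem
    exact hp.pow_dvd_of_dvd_mul_left d (mt Ideal.mem_span_singleton.mpr hm) hmem
  · rwa [one_mul, Ideal.mem_span_singleton]

end VanishingOrder

section VolumeForm

open MvPolynomial

variable {k : Type*} [CommRing k] {σ : Type*} {R : Type*} [CommRing R]
  [Algebra (MvPolynomial σ k) R] [Algebra k R] [IsScalarTower k (MvPolynomial σ k) R]

variable (k σ R) in
/-- The differentials of the coordinates form a basis of the differentials of an algebra which is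
formally étale over affine space. -/
def kaehlerBasis [Algebra.FormallyEtale (MvPolynomial σ k) R] : Module.Basis σ R Ω[R⁄k] :=
  ((KaehlerDifferential.mvPolynomialBasis k σ).baseChange R).map
    (KaehlerDifferential.tensorKaehlerEquivOfFormallyEtale k (MvPolynomial σ k) R)

theorem kaehlerBasis_repr_D [Algebra.FormallyEtale (MvPolynomial σ k) R] (p : MvPolynomial σ k)
    (i : σ) :
    (kaehlerBasis k σ R).repr (KaehlerDifferential.D k R (algebraMap _ R p)) i =
      algebraMap _ R (pderiv i p) := by
  rw [kaehlerBasis, Module.Basis.map_repr, LinearEquiv.trans_apply,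
    KaehlerDifferential.tensorKaehlerEquivOfFormallyEtale_symm_D_algebraMap]
  simp [KaehlerDifferential.mvPolynomialBasis_repr_apply, Algebra.smul_def]

variable [Fintype σ] [DecidableEq σ]

theorem kaehlerBasis_det_D [Algebra.FormallyEtale (MvPolynomial σ k) R] (p : σ → MvPolynomial σ k) :
    (kaehlerBasis k σ R).det (fun j => KaehlerDifferential.D k R (algebraMap _ R (p j))) =
      algebraMap _ R (jacobianDet p) := by
  rw [Module.Basis.det_apply, jacobianDet, RingHom.map_det]
  refine congrArg Matrix.det (Matrix.ext fun i j => ?_)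
  rw [Module.Basis.toMatrix_apply, kaehlerBasis_repr_D]
  rfl

end VolumeForm

open MvPolynomial in
theorem volumeFormOrder_le {k : Type u} [Field k] {n : ℕ} {R : Type u} [CommRing R] [IsLocalRing R]
    [Algebra (MvPolynomial (Fin n) k) R] [Algebra.FormallyEtale (MvPolynomial (Fin n) k) R]
    (φ : MvPolynomial (Fin n) k →ₐ[k] MvPolynomial (Fin n) k) :
    volumeFormOrder ((algebraMap _ R).comp φ.toRingHom) ≤
      vanishingOrder R (algebraMap _ R (jacobianDet fun j => φ (X j))) := by
  let : Algebra k R := (((algebraMap _ R).comp φ.toRingHom).comp C).toAlgebra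
  have : IsScalarTower k (MvPolynomial (Fin n) k) R := IsScalarTower.of_algebraMap_eq fun c =>
    congrArg (algebraMap _ R) (φ.commutes c)
  rw [← kaehlerBasis_det_D, ← exteriorPower.alternatingMapLinearEquiv_apply_ιMulti]
  exact vanishingOrder_le_map _ _

section MonomialOrder

open MvPolynomial

variable {σ : Type*} {k : Type*} [CommRing k]

theorem emultiplicity_X_monomial (i : σ) (m : σ →₀ ℕ) {r : k} (hr : r ≠ 0) :
    emultiplicity (X i) (monomial m r) = m i := by
  refine ENat.eq_of_forall_natCast_le_iff fun d => ?_
  rw [← pow_dvd_iff_le_emultiplicity, X_pow_eq_monomial, monomial_dvd_monomial]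
  simp [hr]

variable [Fintype σ] [DecidableEq σ] {B : Matrix σ σ ℕ}

theorem associated_prod_X_mul_jacobianDet_monomialMap (hB : IsUnimodular B) :
    Associated ((∏ i, X i) * jacobianDet fun j => monomialMap k B (X j))
      (∏ j, monomialMap k B (X j)) := by
  rw [prod_X_mul_jacobianDet_monomialMap]
  exact associated_unit_mul_left _ _
    (((Matrix.isUnit_iff_isUnit_det _).mp hB).map (Int.castRingHom (MvPolynomial σ k)))

theorem emultiplicity_jacobianDet_monomialMap_add_one [IsDomain k] (hB : IsUnimodular B) (i : σ) :
    emultiplicity (X i) (jacobianDet fun j => monomialMap k B (X j)) + 1 =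
      ((∑ j, B i j : ℕ) : ℕ∞) := by
  have hX : emultiplicity (X i) (∏ j, X j : MvPolynomial σ k) = 1 := by
    have hvar (j : σ) : emultiplicity (X i) (X j : MvPolynomial σ k) = (Finsupp.single j 1 i : ℕ) :=
      emultiplicity_X_monomial i (Finsupp.single j 1) one_ne_zero
    simp_rw [Finset.emultiplicity_prod X_prime, hvar]
    simp [Finsupp.single_apply]
  have hB' : emultiplicity (X i) (∏ j, monomialMap k B (X j)) = ((∑ j, B i j : ℕ) : ℕ∞) := by
    simp_rw [Finset.emultiplicity_prod X_prime, monomialMap_X,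
      emultiplicity_X_monomial _ _ one_ne_zero, Nat.cast_sum]
    rfl
  rw [← hB', ← hX, add_comm, ← emultiplicity_mul X_prime]
  exact emultiplicity_eq_of_associated_right (associated_prod_X_mul_jacobianDet_monomialMap hB)

end MonomialOrder

section Stalks

theorem pullbackGerm_comp {R S : CommRingCat.{u}} {Y : Scheme.{u}} (g : Y ⟶ Spec S) (φ : R ⟶ S)
    (y : Y) : pullbackGerm (g ≫ Spec.map φ) y = (pullbackGerm g y).comp φ.hom := by
  rw [pullbackGerm, pullbackGerm, ← CommRingCat.hom_comp, Scheme.Hom.comp_appTop]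
  simp only [Category.assoc]
  rw [← Scheme.ΓSpecIso_inv_naturality_assoc]

theorem isLocalization_pullbackGerm {R : CommRingCat.{u}} {Y : Scheme.{u}} (j : Y ⟶ Spec R)
    [IsOpenImmersion j] {y : Y} {x : PrimeSpectrum R} (hx : j y = x) :
    letI := (pullbackGerm j y).toAlgebra
    IsLocalization.AtPrime (Y.presheaf.stalk y) x.asIdeal := by
  subst hx
  let x : PrimeSpectrum R := j y
  let : Algebra R (Y.presheaf.stalk y) := (pullbackGerm j y).toAlgebra
  let : Algebra R ((Spec R).presheaf.stalk (j y)) := StructureSheaf.stalkAlgebra R x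
  have hloc : IsLocalization.AtPrime ((Spec R).presheaf.stalk (j y)) x.asIdeal :=
    StructureSheaf.IsLocalization.to_stalk R x
  have hgerm : CommRingCat.ofHom (pullbackGerm j y) =
      (Scheme.ΓSpecIso R).inv ≫ (Spec R).presheaf.germ ⊤ (j y) trivial ≫ j.stalkMap y := by
    rw [j.germ_stalkMap ⊤ y trivial]
    rfl
  exact IsLocalization.isLocalization_of_algEquiv x.asIdeal.primeCompl <|
    AlgEquiv.ofRingEquiv (f := (asIso (j.stalkMap y)).commRingCatIsoToRingEquiv) fun r =>
      (congrArg (fun φ => φ.hom r) hgerm).symm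

end Stalks

section BirationalMorphisms

theorem isDominant_of_isOpenImmersion {X Y : Scheme.{u}} (f : X ⟶ Y) [IsOpenImmersion f]
    [Nonempty X] [IrreducibleSpace Y] : IsDominant f :=
  ⟨f.isOpenEmbedding.isOpen_range.dense (Set.range_nonempty f)⟩

theorem birationalOver_id_of_isOpenImmersion_comp {W X Y : Scheme.{u}} (j : W ⟶ X) (g : X ⟶ Y)
    [Nonempty W] [IrreducibleSpace X] [IrreducibleSpace Y] [IsOpenImmersion j]
    [IsOpenImmersion (j ≫ g)] : Scheme.BirationalOver g (𝟙 Y) := by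
  have := isDominant_of_isOpenImmersion j
  have := isDominant_of_isOpenImmersion (j ≫ g)
  exact (j.birationalOver g (j ≫ g) rfl).symm.trans
    ((j ≫ g).birationalOver (𝟙 Y) (j ≫ g) (Category.comp_id _))

theorem birationalOver_morphismRestrict {W X Y : Scheme.{u}} (j : W ⟶ X) (g : X ⟶ Y)
    [Nonempty W] [IrreducibleSpace X] [IrreducibleSpace Y] [IsOpenImmersion j]
    [IsOpenImmersion (j ≫ g)] (U : Y.Opens) (hU : ((g ⁻¹ᵁ U : X.Opens) : Set X).Nonempty) :
    Scheme.BirationalOver (g ∣_ U) (𝟙 U.toScheme) := by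
  obtain ⟨_, hw, w, rfl⟩ := nonempty_preirreducible_inter (g ⁻¹ᵁ U).2
    j.isOpenEmbedding.isOpen_range hU (Set.range_nonempty j)
  have : Nonempty (j ⁻¹ᵁ g ⁻¹ᵁ U).toScheme := ⟨⟨w, hw⟩⟩
  have : Nonempty (g ⁻¹ᵁ U).toScheme := ⟨⟨j w, hw⟩⟩
  have : Nonempty U.toScheme := ⟨⟨g (j w), hw⟩⟩
  have := (g ⁻¹ᵁ U).ι.isOpenEmbedding.irreducibleSpace
  have := U.ι.isOpenEmbedding.irreducibleSpace
  have : IsOpenImmersion ((j ∣_ g ⁻¹ᵁ U) ≫ g ∣_ U) := by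
    rw [← morphismRestrict_comp]
    exact inferInstanceAs (IsOpenImmersion ((j ≫ g) ∣_ U))
  exact birationalOver_id_of_isOpenImmersion_comp (j ∣_ g ⁻¹ᵁ U) (g ∣_ U)

end BirationalMorphisms

section NormalVarieties

variable {k : Type u} [Field k]

theorem IsNormalVariety.opens {Y : Scheme.{u}} {s : Y ⟶ Spec (CommRingCat.of k)}
    (h : IsNormalVariety k s) (V : Y.Opens) [Nonempty V] : IsNormalVariety k (V.ι ≫ s) := by
  obtain ⟨_, _, _, _, hclosed⟩ := h
  have := LocallyOfFiniteType.isLocallyNoetherian s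
  refine ⟨inferInstance, inferInstance, inferInstance, inferInstance, fun y => ?_⟩
  have := hclosed (V.ι y)
  exact .of_equiv (V.stalkIso y).commRingCatIsoToRingEquiv.symm

theorem isNormalVariety_affineSpace (n : ℕ) : IsNormalVariety k (affineSpaceToBase k n) := by
  have : LocallyOfFiniteType (affineSpaceToBase k n) := by
    rw [affineSpaceToBase, HasRingHomProperty.Spec_iff (P := @LocallyOfFiniteType)]
    exact (RingHom.finiteType_algebraMap (A := k) (B := MvPolynomial (Fin n) k)).mpr inferInstance
  refine ⟨inferInstance, ?_, this, ?_, fun y => ?_⟩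
  · rw [affineSpaceToBase]; infer_instance
  · rw [affineSpaceToBase]; infer_instance
  · let := (pullbackGerm (𝟙 (affineSpace k n)) y).toAlgebra
    let x : PrimeSpectrum (MvPolynomial (Fin n) k) := y
    have := isLocalization_pullbackGerm (𝟙 (affineSpace k n)) (x := x) rfl
    exact isIntegrallyClosed_of_isLocalization _ _ x.asIdeal.primeCompl_le_nonZeroDivisors

end NormalVarieties

section ToricBlowUp

variable {k : Type u} [Field k] {n : ℕ}

variable (k) in
/-- The toric morphism of affine spaces given by a matrix of exponents. -/
def monomialMorphism (B : Matrix (Fin n) (Fin n) ℕ) : affineSpace k n ⟶ affineSpace k n :=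
  Spec.map (CommRingCat.ofHom (monomialMap k B).toRingHom)

theorem monomialMorphism_toBase (B : Matrix (Fin n) (Fin n) ℕ) :
    monomialMorphism k B ≫ affineSpaceToBase k n = affineSpaceToBase k n := by
  rw [monomialMorphism, affineSpaceToBase, ← Spec.map_comp, ← CommRingCat.ofHom_comp]
  congr 2
  exact (monomialMap k B).comp_algebraMap

variable (k n) in
/-- The inclusion of the torus, the complement of the coordinate hyperplanes, into affine space. -/
def torusEmbedding : Spec (CommRingCat.of (LaurentRing (Fin n) k)) ⟶ affineSpace k n :=
  Spec.map (CommRingCat.ofHom (algebraMap (MvPolynomial (Fin n) k) (LaurentRing (Fin n) k)))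

instance : IsOpenImmersion (torusEmbedding k n) := by
  unfold torusEmbedding
  infer_instance

instance : Nontrivial (LaurentRing (Fin n) k) :=
  algebraMap_laurentRing_injective.nontrivial

variable {B : Matrix (Fin n) (Fin n) ℕ}

theorem torusEmbedding_comp_monomialMorphism (hB : IsUnimodular B) :
    torusEmbedding k n ≫ monomialMorphism k B =
      Spec.map (laurentEquiv k hB.unit).toRingEquiv.toCommRingCatIso.hom ≫ torusEmbedding k n := by
  rw [torusEmbedding, monomialMorphism, ← Spec.map_comp, ← Spec.map_comp]
  exact congrArg Spec.map (CommRingCat.hom_ext (RingHom.ext (algebraMap_monomialMap hB)))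

theorem birationalOver_monomialMorphism_morphismRestrict (hB : IsUnimodular B)
    (U : (affineSpace k n).Opens) (hU : ((monomialMorphism k B ⁻¹ᵁ U : (affineSpace k n).Opens) :
      Set (affineSpace k n)).Nonempty) :
    Scheme.BirationalOver (monomialMorphism k B ∣_ U) (𝟙 U.toScheme) := by
  have : IsOpenImmersion (torusEmbedding k n ≫ monomialMorphism k B) := by
    rw [torusEmbedding_comp_monomialMorphism hB]
    infer_instance
  exact birationalOver_morphismRestrict (torusEmbedding k n) (monomialMorphism k B) U hU

instance isPrime_span_X (i : Fin n) :
    (Ideal.span {(MvPolynomial.X i : MvPolynomial (Fin n) k)}).IsPrime :=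
  (Ideal.span_singleton_prime (MvPolynomial.X_ne_zero i)).mpr MvPolynomial.X_prime

variable (k) in
/-- The generic point of the coordinate hyperplane `x_i = 0`. -/
def hyperplanePoint (i : Fin n) : affineSpace k n :=
  (⟨Ideal.span {(MvPolynomial.X i : MvPolynomial (Fin n) k)}, isPrime_span_X i⟩ :
    PrimeSpectrum (MvPolynomial (Fin n) k))

theorem coheight_hyperplanePoint (i : Fin n) : Order.coheight (hyperplanePoint k i) = 1 := by
  rw [← idealHeight_eq_coheight]
  exact Ideal.height_span_singleton_eq_one_of_mem_nonZeroDivisors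
    (mem_nonZeroDivisors_of_ne_zero (MvPolynomial.X_ne_zero i)) MvPolynomial.X_prime.not_isUnit

theorem monomialMorphism_hyperplanePoint_specializes (hB : IsUnimodular B) (i : Fin n) :
    monomialMorphism k B (hyperplanePoint k i) ⤳ origin k n := by
  refine (PrimeSpectrum.le_iff_specializes _ _).mp fun p hp => ?_
  obtain ⟨q, hq⟩ : MvPolynomial.X i ∣ monomialMap k B p := Ideal.mem_span_singleton.mp hp
  change MvPolynomial.constantCoeff p = 0
  rw [← constantCoeff_monomialMap hB, hq]
  simp

theorem monomialMorphism_hyperplanePoint_mem (hB : IsUnimodular B) (i : Fin n)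
    {U : (affineSpace k n).Opens} (hU : origin k n ∈ U) :
    monomialMorphism k B (hyperplanePoint k i) ∈ U :=
  (monomialMorphism_hyperplanePoint_specializes hB i).mem_open U.2 hU

/-- The divisor over a neighbourhood `U` of the origin given by the coordinate hyperplane `x_i = 0`
in the chart `monomialMorphism k B`. For `B i` proportional to `w` this is the exceptional divisor
of the weighted blow-up with weights `w`. -/
def toricDivisor (hB : IsUnimodular B) (i : Fin n) {U : (affineSpace k n).Opens}
    (hU : origin k n ∈ U) : PrimeDivisorOver k (U.ι ≫ affineSpaceToBase k n) where
  Y := (monomialMorphism k B ⁻¹ᵁ U).toScheme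
  π := monomialMorphism k B ∣_ U
  isNormalVariety := by
    have : Nonempty (monomialMorphism k B ⁻¹ᵁ U) :=
      ⟨⟨hyperplanePoint k i, monomialMorphism_hyperplanePoint_mem hB i hU⟩⟩
    rw [morphismRestrict_ι_assoc, monomialMorphism_toBase]
    exact (isNormalVariety_affineSpace n).opens _
  birational := birationalOver_monomialMorphism_morphismRestrict hB U
    ⟨hyperplanePoint k i, monomialMorphism_hyperplanePoint_mem hB i hU⟩
  genericPoint := ⟨hyperplanePoint k i, monomialMorphism_hyperplanePoint_mem hB i hU⟩
  codim_one := (coheight_eq_of_isOpenImmersion (monomialMorphism k B ⁻¹ᵁ U).ι).symm.trans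
    (coheight_hyperplanePoint i)

end ToricBlowUp

section Discrepancy

/-- The local ring of a model at the generic point of a prime divisor on it. -/
abbrev PrimeDivisorOver.LocalRing {k : Type u} [Field k] {X : Scheme.{u}}
    {s : X ⟶ Spec (CommRingCat.of k)} (E : PrimeDivisorOver k s) : Type u :=
  E.Y.presheaf.stalk E.genericPoint

variable {k : Type u} [Field k] {n : ℕ} {B : Matrix (Fin n) (Fin n) ℕ} (hB : IsUnimodular B)
  (i : Fin n) {U : (affineSpace k n).Opens} (hU : origin k n ∈ U)

/-- The polynomial ring is the coordinate ring of the chart here; the coordinate ring of the base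
maps to the local ring through `monomialMap k B`. -/
instance : Algebra (MvPolynomial (Fin n) k) (toricDivisor hB i hU).LocalRing :=
  (pullbackGerm (monomialMorphism k B ⁻¹ᵁ U).ι (toricDivisor hB i hU).genericPoint).toAlgebra

instance : IsLocalization.AtPrime (toricDivisor hB i hU).LocalRing
    (Ideal.span {(MvPolynomial.X i : MvPolynomial (Fin n) k)}) :=
  isLocalization_pullbackGerm (monomialMorphism k B ⁻¹ᵁ U).ι (x := hyperplanePoint k i) rfl

theorem pullbackGerm_toricDivisor :
    pullbackGerm ((toricDivisor hB i hU).π ≫ U.ι) (toricDivisor hB i hU).genericPoint =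
      (algebraMap (MvPolynomial (Fin n) k) (toricDivisor hB i hU).LocalRing).comp
        (monomialMap k B).toRingHom :=
  (congrArg (pullbackGerm · _) (morphismRestrict_ι (monomialMorphism k B) U)).trans
    (pullbackGerm_comp _ _ _)

theorem volumeFormOrder_toricDivisor_add_one_le :
    volumeFormOrder (pullbackGerm ((toricDivisor hB i hU).π ≫ U.ι)
      (toricDivisor hB i hU).genericPoint) + 1 ≤ ((∑ j, B i j : ℕ) : ℕ∞) := by
  have := Algebra.FormallyEtale.of_isLocalization (Rₘ := (toricDivisor hB i hU).LocalRing)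
    (Ideal.span {(MvPolynomial.X i : MvPolynomial (Fin n) k)}).primeCompl
  rw [pullbackGerm_toricDivisor, ← emultiplicity_jacobianDet_monomialMap_add_one (k := k) hB i,
    ← vanishingOrder_algebraMap (R := (toricDivisor hB i hU).LocalRing) MvPolynomial.X_prime]
  gcongr
  exact volumeFormOrder_le (monomialMap k B)

theorem vanishingOrder_toricDivisor (f : MvPolynomial (Fin n) k) :
    vanishingOrder (toricDivisor hB i hU).LocalRing
      (pullbackGerm ((toricDivisor hB i hU).π ≫ U.ι) (toricDivisor hB i hU).genericPoint f) =
      emultiplicity (MvPolynomial.X i) (monomialMap k B f) := by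
  rw [← vanishingOrder_algebraMap (R := (toricDivisor hB i hU).LocalRing) MvPolynomial.X_prime]
  exact congrArg (vanishingOrder _) (RingHom.congr_fun (pullbackGerm_toricDivisor hB i hU) f)

end Discrepancy

section WeightedMultiplicity

variable {k : Type u} [Field k] {n : ℕ}

variable {f : MvPolynomial (Fin n) k} (hf : f ≠ 0)
include hf

theorem isLeast_weightedMultiplicity (w : Fin n → ℕ) :
    IsLeast {d | ∃ m ∈ f.support, d = ∑ i, m i * w i} (weightedMultiplicity w f) := by
  obtain ⟨m, hm⟩ := MvPolynomial.support_nonempty.mpr hf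
  exact ⟨Nat.sInf_mem ⟨_, m, hm, rfl⟩, fun d hd => Nat.sInf_le hd⟩

theorem weightedMultiplicity_smul (g : ℕ) (w : Fin n → ℕ) :
    weightedMultiplicity (g • w) f = g * weightedMultiplicity w f := by
  obtain ⟨⟨m, hm, hmin⟩, hle⟩ := isLeast_weightedMultiplicity hf w
  have hsmul (m : Fin n →₀ ℕ) : ∑ i, m i * (g • w) i = g * ∑ i, m i * w i := by
    simp [Finset.mul_sum, mul_left_comm]
  refine (isLeast_weightedMultiplicity hf (g • w)).unique ⟨⟨m, hm, ?_⟩, ?_⟩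
  · rw [hsmul, hmin]
  · rintro _ ⟨m', hm', rfl⟩
    rw [hsmul]
    exact Nat.mul_le_mul_left g (hle ⟨m', hm', rfl⟩)

theorem weightedMultiplicity_le_emultiplicity_monomialMap (B : Matrix (Fin n) (Fin n) ℕ)
    (i : Fin n) :
    weightedMultiplicity (B i) f ≤ emultiplicity (MvPolynomial.X i) (monomialMap k B f) :=
  le_emultiplicity_of_pow_dvd <| X_pow_dvd_monomialMap B fun m hm =>
    (isLeast_weightedMultiplicity hf (B i)).2 ⟨m, hm, rfl⟩

theorem discrepancy_toricDivisor_le {B : Matrix (Fin n) (Fin n) ℕ} (hB : IsUnimodular B)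
    (i : Fin n) {U : (affineSpace k n).Opens} (hU : origin k n ∈ U) (c : ℝ≥0) :
    discrepancy U f c (toricDivisor hB i hU) + 1 ≤
      ∑ j, (B i j : ℝ) - c * weightedMultiplicity (B i) f := by
  have hvol := volumeFormOrder_toricDivisor_add_one_le (k := k) hB i hU
  have hord := weightedMultiplicity_le_emultiplicity_monomialMap hf B i
  have hmul : FiniteMultiplicity (MvPolynomial.X i) (monomialMap k B f) :=
    .of_prime_left MvPolynomial.X_prime
      ((map_ne_zero_iff _ (monomialMap_injective hB)).mpr hf)
  obtain ⟨v, hv⟩ := ENat.ne_top_iff_exists.mp <|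
    ne_top_of_le_ne_top (ENat.natCast_ne_top _) (le_self_add.trans hvol)
  rw [← hv] at hvol
  rw [hmul.emultiplicity_eq_multiplicity] at hord
  have hvol' : (v : ℝ) + 1 ≤ ∑ j, (B i j : ℝ) := by exact_mod_cast hvol
  have hord' : (c : ℝ) * weightedMultiplicity (B i) f ≤
      c * multiplicity (MvPolynomial.X i) (monomialMap k B f) := by
    gcongr
    exact_mod_cast hord
  rw [discrepancy, vanishingOrder_toricDivisor, ← hv, hmul.emultiplicity_eq_multiplicity,
    ENat.toNat_natCast, ENat.toNat_natCast]
  linarith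

theorem mul_weightedMultiplicity_le_of_isLogCanonicalAt {w : Fin n → ℕ} (hw : w ≠ 0) {c : ℝ≥0}
    (hc : IsLogCanonicalAt (origin k n) f c) : c * weightedMultiplicity w f ≤ ∑ i, (w i : ℝ≥0) := by
  obtain ⟨U, hU, hlc⟩ := hc
  obtain ⟨B, i, g, hB, -, rfl⟩ := exists_isUnimodular_smul_row_eq w hw
  have hdisc := discrepancy_toricDivisor_le hf hB i hU c
  have hrow : c * weightedMultiplicity (B i) f ≤ ∑ j, (B i j : ℝ≥0) := by
    rw [← NNReal.coe_le_coe]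
    push_cast
    linarith [hlc (toricDivisor hB i hU)]
  calc (c : ℝ≥0) * weightedMultiplicity (g • B i) f = g * (c * weightedMultiplicity (B i) f) := by
        rw [weightedMultiplicity_smul hf]; push_cast; ring
    _ ≤ g * ∑ j, (B i j : ℝ≥0) := by gcongr
    _ = ∑ j, ((g • B i) j : ℝ≥0) := by simp [Finset.mul_sum]

theorem weightedMultiplicity_mul_lctAt_origin_le {w : Fin n → ℕ} (hw : w ≠ 0) :
    weightedMultiplicity w f * lctAt (origin k n) f ≤ ∑ i, (w i : ℝ≥0∞) := by
  simp_rw [lctAt, ENNReal.mul_iSup]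
  refine iSup₂_le fun c hc => ?_
  rw [mul_comm]
  exact_mod_cast mul_weightedMultiplicity_le_of_isLogCanonicalAt hf hw hc

end WeightedMultiplicity

end LogCanonical

end

theorem proposition4p7_general {k : Type u} [Field k] {n : ℕ}
    (f : MvPolynomial (Fin n) k) (hf : f ≠ 0) (w : Fin n → ℕ) (hw : w ≠ 0) :
    1 / LogCanonical.lctAt (LogCanonical.origin k n) f ≥
      (LogCanonical.weightedMultiplicity w f : ℝ≥0∞) / (∑ i, (w i : ℝ≥0∞)) := by
  rw [ge_iff_le, one_div, ENNReal.le_inv_iff_mul_le, ← ENNReal.mul_div_right_comm]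
  exact (ENNReal.div_le_div_right
    (LogCanonical.weightedMultiplicity_mul_lctAt_origin_le hf hw) _).trans ENNReal.div_self_le_one

theorem proposition4p7 {k : Type u} [Field k] [IsAlgClosed k] {n : ℕ}
    (f : MvPolynomial (Fin n) k) (hf : f ≠ 0) (w : Fin n → ℕ) (hw : w ≠ 0) :
    1 / LogCanonical.lctAt (LogCanonical.origin k n) f ≥
      (LogCanonical.weightedMultiplicity w f : ℝ≥0∞) / (∑ i, (w i : ℝ≥0∞)) :=
  proposition4p7_general f hf w hw
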